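/- \textbf{Definitions.} A \emph{stochastic first-order oracle} on $\mathbb{R}^d$ consists of a probability distribution $\nu$ on a sample space $Z$ and a jointly measurable map $g:\mathbb{R}^d\times Z\to\mathbb{R}^d$; queried at $x$, it draws a fresh $z\sim\nu$ and returns $g(x,z)$. A (possibly randomized) \emph{first-order algorithm} on $\mathbb{R}^d$ draws a random seed $r$ once and chooses its $t$-th iterate as a measurable function $x_t=A_t(r,g_1,\dots,g_{t-1})$ of the seed and the earlier answers, where $g_s=g(x_s,z_s)$ and $z_1,z_2,\dots$ are i.i.d. with law $\nu$ and independent of $r$. It is \emph{zero-respecting} (on the given oracle) if almost surely $\mathrm{support}(x_t)\subseteq\bigcup_{s<t}\mathrm{support}(g_s)$ for all $t\ge 1$, where $\mathrm{support}(v)=\{i: v[i]\neq 0\}$. \textbf{Theorem.} For every $p\in(1,2]$ there is a constant $c>0$, depending only on $p$, such that for all $\Delta_1,L_0,\sigma_0>0$ there is an $\varepsilon_0>0$ such that for every $\varepsilon\in(0,\varepsilon_0]$ there exist a dimension $d$, a function $F:\mathbb{R}^d\to\mathbb{R}$ and a stochastic first-order oracle $(\nu,g)$ on $\mathbb{R}^d$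 with the following properties. \begin{itemize} \item $F$ is bounded below and $F(0)-\inf_{x\in\mathbb{R}^d}F(x)\le\Delta_1$. \item $F$ is differentiable and $\|\nabla F(x)-\nabla F(y)\|\le L_0\|x-y\|$ for all $x,y\in\mathbb{R}^d$ (Euclidean norm). \item For every $x\in\mathbb{R}^d$, $g(x,\cdot)$ is $\nu$-integrable, $\mathbb{E}_{z\sim\nu}[g(x,z)]=\nabla F(x)$ and $\mathbb{E}_{z\sim\nu}\big[\|g(x,z)-\nabla F(x)\|^{p}\big]\le\sigma_0^{p}$. \item For every zero-respecting first-order algorithm started at $x_1=0$ and run on this oracle, one has $\mathbb{E}\big[\|\nabla F(x_t)\|\big]>\varepsilon$ for every integer $t\ge 1$ with $$t\le c\,\Delta_1 L_0\,\sigma_0^{\frac{p}{p-1}}\,\varepsilon^{-\frac{3p-2}{p-1}}.$$ \end{itemize} That is, any such algorithm needs $\Omega\big(\Delta_1L_0\sigma_0^{p/(p-1)}\varepsilon^{-(3p-2)/(p-1)}\big)$ iterations to reach $\mathbb{E}\|\nabla F(x_t)\|\le\varepsilon$. -/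

import Mathlib

open MeasureTheory

universe u

/-- `ℝ^d` with the Euclidean norm. -/
abbrev Vec (d : ℕ) : Type := EuclideanSpace ℝ (Fin d)

/-- `F` is bounded below on `ℝ^d` and `F(0) - inf F ≤ Δ`. -/
def InitialGapAtMost {d : ℕ} (F : Vec d → ℝ) (Δ : ℝ) : Prop :=
  BddBelow (Set.range F) ∧ F 0 - ⨅ x, F x ≤ Δ

/-- `F` is differentiable and its gradient is `L`-Lipschitz for the Euclidean norm. -/
def IsSmoothFun {d : ℕ} (F : Vec d → ℝ) (L : ℝ) : Prop :=
  Differentiable ℝ F ∧ ∀ x y : Vec d, ‖gradient F x - gradient F y‖ ≤ L * ‖x - y‖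

/-- A stochastic first-order oracle on `ℝ^d`: queried at `x`, it draws a fresh sample `z` from the
probability distribution `law` and returns the single vector `grad x z`. -/
structure StochasticOracle (d : ℕ) where
  Sample : Type
  [mSample : MeasurableSpace Sample]
  law : Measure Sample
  [isProb : IsProbabilityMeasure law]
  grad : Vec d → Sample → Vec d
  measurable_grad : Measurable (Function.uncurry grad)

attribute [instance] StochasticOracle.mSample StochasticOracle.isProb

namespace StochasticOracle

variable {d : ℕ}

/-- At every query point the answer has a finite mean, equal to the gradient of `F`. -/
def IsUnbiased (O : StochasticOracle d) (F : Vec d → ℝ) : Prop :=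
  ∀ x, Integrable (O.grad x) O.law ∧ ∫ z, O.grad x z ∂O.law = gradient F x

/-- At every query point the `p`-th moment of the noise is at most `σ ^ p`. -/
def NoiseMomentAtMost (O : StochasticOracle d) (F : Vec d → ℝ) (p σ : ℝ) : Prop :=
  ∀ x, ∫⁻ z, ‖O.grad x z - gradient F x‖ₑ ^ p ∂O.law ≤ ENNReal.ofReal (σ ^ p)

end StochasticOracle

/-- A (possibly randomized) first-order algorithm on `ℝ^d`. It draws a seed `r` once, and its next
query after receiving the `t` answers `g 0, …, g (t - 1)` is `step t (r, g)`. -/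
structure FirstOrderAlgorithm (d : ℕ) where
  Seed : Type u
  [mSeed : MeasurableSpace Seed]
  seedLaw : Measure Seed
  [isProb : IsProbabilityMeasure seedLaw]
  step : (t : ℕ) → Seed × (Fin t → Vec d) → Vec d
  measurable_step : ∀ t, Measurable (step t)

attribute [instance] FirstOrderAlgorithm.mSeed FirstOrderAlgorithm.isProb

namespace FirstOrderAlgorithm

variable {d : ℕ}

/-- The outcomes of a run: the seed of the algorithm and one oracle sample for each iteration. -/
abbrev RunSpace (A : FirstOrderAlgorithm.{u} d) (O : StochasticOracle d) : Type u :=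
  A.Seed × (ℕ → O.Sample)

/-- The law of a run: the oracle samples are i.i.d. and independent of the seed. -/
noncomputable def runLaw (A : FirstOrderAlgorithm.{u} d) (O : StochasticOracle d) :
    Measure (A.RunSpace O) :=
  A.seedLaw.prod (Measure.infinitePi fun _ : ℕ => O.law)

/-- The first `t` answers that the algorithm receives in a run. -/
def answers (A : FirstOrderAlgorithm.{u} d) (O : StochasticOracle d) (ω : A.RunSpace O) :
    (t : ℕ) → Fin t → Vec d
  | 0 => Fin.elim0
  | t + 1 => Fin.snoc (α := fun _ => Vec d) (A.answers O ω t)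
      (O.grad (A.step t (ω.1, A.answers O ω t)) (ω.2 t))

/-- The iterates of a run, numbered from `0`: `A.iterate O t` is chosen after `t` answers, hence
is the `(t + 1)`-st iterate. -/
def iterate (A : FirstOrderAlgorithm.{u} d) (O : StochasticOracle d) (t : ℕ) (ω : A.RunSpace O) :
    Vec d :=
  A.step t (ω.1, A.answers O ω t)

/-- The answer of the oracle at the iterate with number `t`. -/
def answer (A : FirstOrderAlgorithm.{u} d) (O : StochasticOracle d) (t : ℕ) (ω : A.RunSpace O) :
    Vec d :=
  O.grad (A.iterate O t ω) (ω.2 t)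

/-- The algorithm starts at the point `x₁`. -/
def StartsAt (A : FirstOrderAlgorithm.{u} d) (O : StochasticOracle d) (x₁ : Vec d) : Prop :=
  ∀ᵐ ω ∂A.runLaw O, A.iterate O 0 ω = x₁

/-- The algorithm is zero-respecting when run on the oracle `O`: almost surely, the support of
every iterate is contained in the union of the supports of the earlier answers. -/
def IsZeroRespecting (A : FirstOrderAlgorithm.{u} d) (O : StochasticOracle d) : Prop :=
  ∀ᵐ ω ∂A.runLaw O, ∀ t : ℕ,
    Function.support (fun i => A.iterate O t ω i) ⊆
      ⋃ s < t, Function.support (fun i => A.answer O s ω i)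

/-- The expected gradient norm, with values in `[0, ∞]`, at the iterate with number `t`. -/
noncomputable def expectedGradNorm (A : FirstOrderAlgorithm.{u} d) (O : StochasticOracle d)
    (F : Vec d → ℝ) (t : ℕ) : ENNReal :=
  ∫⁻ ω, ‖gradient F (A.iterate O t ω)‖ₑ ∂A.runLaw O

end FirstOrderAlgorithm

/-!
On the hard function a coordinate is worth moving only after its predecessor, so a gradient reveals
at most one coordinate beyond those already discovered, and the gradient stays large until all `d`
coordinates are discovered. The oracle hides the entry at this frontier, except with probability
`q`, when it shows it inflated by `1 / q`. A zero-respecting algorithm then discovers at most as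
many coordinates as there are successes in a sequence of Bernoulli trials, so by Markov's inequality
some coordinate is still undiscovered after `t` queries with probability at least `1 / 2` as long as
`2 * t * q < d`. A frontier entry of size `b` makes the `p`-th moment of the noise at most
`2 * b ^ p * q ^ (1 - p)`, and a function with Lipschitz constant `L` and gradient entries of size
`b` decreases by `b ^ 2 / L` per coordinate, up to a constant. Hence `b ≈ ε`,
`q ≈ (ε / σ) ^ (p / (p - 1))` and `d ≈ Δ * L / ε ^ 2`, and the number of queries is of the order of
`d / q`.
-/

open ProbabilityTheory

section ZeroChains

variable {d : ℕ}

/-- All coordinates of `x` with (zero-based) index at least `n` vanish. The least such `n` is the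
progress of `x` along the chain of coordinates. -/
def SupportedBelow (x : Vec d) (n : ℕ) : Prop := ∀ i : Fin d, n ≤ i → x i = 0

theorem SupportedBelow.mono {x : Vec d} {m n : ℕ} (hx : SupportedBelow x m) (hmn : m ≤ n) :
    SupportedBelow x n := fun i hi => hx i (hmn.trans hi)

theorem SupportedBelow.add {x y : Vec d} {n : ℕ} (hx : SupportedBelow x n)
    (hy : SupportedBelow y n) : SupportedBelow (x + y) n := fun i hi => by
  rw [PiLp.add_apply, hx i hi, hy i hi, add_zero]

theorem SupportedBelow.smul {x : Vec d} {n : ℕ} (hx : SupportedBelow x n) (c : ℝ) :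
    SupportedBelow (c • x) n := fun i hi => by
  rw [PiLp.smul_apply, hx i hi, smul_zero]

theorem measurableSet_supportedBelow (n : ℕ) : MeasurableSet {x : Vec d | SupportedBelow x n} := by
  simp only [SupportedBelow, Set.ofPred_forall]
  exact .iInter fun i => .iInter fun _ =>
    measurableSet_eq_fun (by fun_prop) measurable_const

/-- A first-order zero-chain: a gradient discovers at most one new coordinate, the next one. -/
def IsZeroChain (F : Vec d → ℝ) : Prop :=
  ∀ (x : Vec d) (n : ℕ), SupportedBelow x n → SupportedBelow (gradient F x) (n + 1)

namespace StochasticOracle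

/-- A stochastic zero-chain: an answer discovers at most one new coordinate, the next one, and
discovers none unless the sample lies in `S`. The set `S` does not depend on the query point, so
that the progress of any algorithm is at most the number of samples in `S`. -/
structure IsZeroChain (O : StochasticOracle d) (S : Set O.Sample) : Prop where
  supportedBelow_succ : ∀ {x : Vec d} {n : ℕ} (z : O.Sample),
    SupportedBelow x n → SupportedBelow (O.grad x z) (n + 1)
  supportedBelow_of_notMem : ∀ {x : Vec d} {n : ℕ} {z : O.Sample}, z ∉ S →
    SupportedBelow x n → SupportedBelow (O.grad x z) n

end StochasticOracle

end ZeroChains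

section CountingSamples

variable {α : Type*} {S : Set α}

open Classical in
theorem natCast_count_mem (z : ℕ → α) (t : ℕ) :
    (Nat.count (z · ∈ S) t : ENNReal) = ∑ s ∈ Finset.range t, S.indicator 1 (z s) := by
  simp [Nat.count_eq_card_filter_range, Set.indicator_apply]

variable [MeasurableSpace α]

open Classical in
theorem measurable_natCast_count_mem (hS : MeasurableSet S) (t : ℕ) :
    Measurable fun z : ℕ → α => (Nat.count (z · ∈ S) t : ENNReal) := by
  simp only [natCast_count_mem]
  exact Finset.measurable_fun_sum _ fun s _ =>
    (measurable_one.indicator hS).comp (measurable_pi_apply s)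

open Classical in
theorem lintegral_count_mem (μ : Measure α) [IsProbabilityMeasure μ] (hS : MeasurableSet S)
    (t : ℕ) :
    ∫⁻ z, (Nat.count (z · ∈ S) t : ENNReal) ∂Measure.infinitePi (fun _ : ℕ => μ) = t * μ S := by
  have hmeas : Measurable (S.indicator (1 : α → ENNReal)) := measurable_one.indicator hS
  have hsample (s : ℕ) :
      ∫⁻ z : ℕ → α, S.indicator 1 (z s) ∂Measure.infinitePi (fun _ : ℕ => μ) = μ S := by
    rw [(measurePreserving_eval_infinitePi (fun _ : ℕ => μ) s).lintegral_comp hmeas,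
      lintegral_indicator_one hS]
  simp only [natCast_count_mem]
  rw [lintegral_finsetSum (f := fun s (z : ℕ → α) => S.indicator 1 (z s)) _
    fun s _ => hmeas.comp (measurable_pi_apply s)]
  simp only [hsample, Finset.sum_const, Finset.card_range, nsmul_eq_mul]

open Classical in
theorem measurableSet_count_mem_lt (hS : MeasurableSet S) (t d : ℕ) :
    MeasurableSet {z : ℕ → α | Nat.count (z · ∈ S) t < d} := by
  simpa only [Nat.cast_lt] using
    measurableSet_lt (measurable_natCast_count_mem hS t) (measurable_const (a := (d : ENNReal)))

open Classical in
theorem half_le_measure_count_mem_lt (μ : Measure α) [IsProbabilityMeasure μ]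
    (hS : MeasurableSet S) {t d : ℕ} (htd : 2 * (t * μ S) < d) :
    2⁻¹ ≤ Measure.infinitePi (fun _ : ℕ => μ) {z | Nat.count (z · ∈ S) t < d} := by
  set P := Measure.infinitePi (fun _ : ℕ => μ)
  have hmarkov : P {z | (d : ENNReal) ≤ Nat.count (z · ∈ S) t} ≤ 2⁻¹ := by
    refine (meas_ge_le_lintegral_div (measurable_natCast_count_mem hS t).aemeasurable
      (ne_zero_of_lt htd) (ENNReal.natCast_ne_top d)).trans (ENNReal.div_le_of_le_mul ?_)
    rw [lintegral_count_mem μ hS, ← ENNReal.div_eq_inv_mul,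
      ENNReal.le_div_iff_mul_le (by simp) (by simp), mul_comm]
    exact htd.le
  calc (2⁻¹ : ENNReal) = 1 - 2⁻¹ := ENNReal.one_sub_inv_two.symm
    _ ≤ 1 - P {z | (d : ENNReal) ≤ Nat.count (z · ∈ S) t} := tsub_le_tsub_left hmarkov 1
    _ = P {z | Nat.count (z · ∈ S) t < d} := by
      rw [← prob_compl_eq_one_sub
        (measurableSet_le measurable_const (measurable_natCast_count_mem hS t))]
      congr 1
      ext z
      simp

end CountingSamples

section ZeroRespecting

variable {d : ℕ} {O : StochasticOracle d} {S : Set O.Sample}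

open Classical in
theorem StochasticOracle.IsZeroChain.supportedBelow_iterate (hO : O.IsZeroChain S)
    (A : FirstOrderAlgorithm.{u} d) (ω : A.RunSpace O)
    (hω : ∀ t : ℕ, Function.support (fun i => A.iterate O t ω i) ⊆
      ⋃ s < t, Function.support (fun i => A.answer O s ω i)) (t : ℕ) :
    SupportedBelow (A.iterate O t ω) (Nat.count (ω.2 · ∈ S) t) := by
  have hmono : Monotone (Nat.count (ω.2 · ∈ S)) := Nat.count_monotone _
  induction t using Nat.strong_induction_on with
  | _ t ih =>
    have hanswer (s : ℕ) (hs : s < t) :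
        SupportedBelow (A.answer O s ω) (Nat.count (ω.2 · ∈ S) (s + 1)) := by
      rw [Nat.count_succ]
      split_ifs with hmem
      · exact hO.supportedBelow_succ _ (ih s hs)
      · exact hO.supportedBelow_of_notMem hmem (ih s hs)
    intro i hi
    by_contra hne
    obtain ⟨s, hs, hsupp⟩ : ∃ s < t, A.answer O s ω i ≠ 0 := by simpa using hω t hne
    exact hsupp (hanswer s hs i ((hmono hs).trans hi))

theorem StochasticOracle.IsZeroChain.half_mul_le_expectedGradNorm (hO : O.IsZeroChain S)
    (hS : MeasurableSet S) {F : Vec d → ℝ} {G : ENNReal}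
    (hG : ∀ x n, n < d → SupportedBelow x n → G ≤ ‖gradient F x‖ₑ)
    (A : FirstOrderAlgorithm.{u} d) (hA : A.IsZeroRespecting O) {t : ℕ}
    (htd : 2 * (t * O.law S) < d) :
    G * 2⁻¹ ≤ A.expectedGradNorm O F t := by
  classical
  set undiscovered : Set (A.RunSpace O) :=
    Prod.snd ⁻¹' {z : ℕ → O.Sample | Nat.count (z · ∈ S) t < d}
  have hcount := measurableSet_count_mem_lt hS t d
  have hprob : 2⁻¹ ≤ A.runLaw O undiscovered := by
    rw [FirstOrderAlgorithm.runLaw,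
      measurePreserving_snd.measure_preimage hcount.nullMeasurableSet]
    exact half_le_measure_count_mem_lt O.law hS htd
  calc G * 2⁻¹ ≤ G * A.runLaw O undiscovered := by gcongr
    _ = ∫⁻ _ in undiscovered, G ∂A.runLaw O := (setLIntegral_const _ _).symm
    _ ≤ ∫⁻ ω in undiscovered, ‖gradient F (A.iterate O t ω)‖ₑ ∂A.runLaw O := by
      refine setLIntegral_mono_ae' (measurable_snd hcount) ?_
      filter_upwards [hA] with ω hω hlt
      exact hG _ _ hlt (hO.supportedBelow_iterate A ω hω t)
    _ ≤ A.expectedGradNorm O F t := setLIntegral_le_lintegral _ _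

end ZeroRespecting

section FrontierOracle

variable {d : ℕ} {F : Vec d → ℝ}

theorem measurable_gradient {E : Type*} [NormedAddCommGroup E] [InnerProductSpace ℝ E]
    [CompleteSpace E] [MeasurableSpace E] [BorelSpace E] (f : E → ℝ) :
    Measurable (gradient f) := by
  borelize (StrongDual ℝ E)
  exact (InnerProductSpace.toDual ℝ E).symm.continuous.measurable.comp (measurable_fderiv ℝ f)

/-- The part of the gradient of `F` on the coordinates beyond the progress of the point. For a
zero-chain `F` at most one of its entries is nonzero: the one that a query could discover. -/
noncomputable def frontierGrad (F : Vec d → ℝ) (x : Vec d) : Vec d :=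
  WithLp.toLp 2 fun i => {y | SupportedBelow y i}.indicator (fun y => gradient F y i) x

theorem frontierGrad_apply_of_supportedBelow {x : Vec d} {i : Fin d} (hx : SupportedBelow x i) :
    frontierGrad F x i = gradient F x i :=
  Set.indicator_of_mem (s := {y | SupportedBelow y i}) hx fun y => gradient F y i

theorem supportedBelow_of_frontierGrad_apply_ne_zero {x : Vec d} {i : Fin d}
    (hi : frontierGrad F x i ≠ 0) : SupportedBelow x i :=
  Set.mem_of_indicator_ne_zero (s := {y | SupportedBelow y i}) (f := fun y => gradient F y i) hi

theorem measurable_frontierGrad (F : Vec d → ℝ) : Measurable (frontierGrad F) := by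
  refine (WithLp.measurable_toLp 2 _).comp (measurable_pi_lambda _ fun i => ?_)
  have hgrad := measurable_gradient F
  exact Measurable.indicator (by fun_prop) (measurableSet_supportedBelow _)

theorem IsZeroChain.supportedBelow_frontierGrad (hF : IsZeroChain F) {x : Vec d} {n : ℕ}
    (hx : SupportedBelow x n) : SupportedBelow (frontierGrad F x) (n + 1) := fun i hi => by
  rw [frontierGrad_apply_of_supportedBelow (hx.mono (by lia)), hF x n hx i hi]

theorem supportedBelow_gradient_sub_frontierGrad {x : Vec d} {n : ℕ} (hx : SupportedBelow x n) :
    SupportedBelow (gradient F x - frontierGrad F x) n := fun i hi => by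
  rw [PiLp.sub_apply, frontierGrad_apply_of_supportedBelow (hx.mono hi), sub_self]

theorem IsZeroChain.eq_of_frontierGrad_apply_ne_zero (hF : IsZeroChain F) {x : Vec d}
    {i j : Fin d} (hi : frontierGrad F x i ≠ 0) (hj : frontierGrad F x j ≠ 0) : i = j := by
  wlog hij : i < j generalizing i j
  · rcases not_lt.1 hij |>.eq_or_lt with h | h
    · exact h.symm
    · exact (this hj hi h).symm
  exact absurd (hF.supportedBelow_frontierGrad
    (supportedBelow_of_frontierGrad_apply_ne_zero hi) j hij) hj

theorem IsZeroChain.norm_frontierGrad_le (hF : IsZeroChain F) {b : ℝ} (hb : 0 ≤ b)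
    (hFb : ∀ (x : Vec d) (i : Fin d), SupportedBelow x i → |gradient F x i| ≤ b) (x : Vec d) :
    ‖frontierGrad F x‖ ≤ b := by
  by_cases hzero : ∃ i, frontierGrad F x i ≠ 0
  · obtain ⟨i, hi⟩ := hzero
    have hx := supportedBelow_of_frontierGrad_apply_ne_zero hi
    have hsingle : frontierGrad F x = EuclideanSpace.single i (gradient F x i) := by
      ext j
      rcases eq_or_ne j i with rfl | hji
      · simp [frontierGrad_apply_of_supportedBelow hx]
      · simpa [hji] using fun hj => hji (hF.eq_of_frontierGrad_apply_ne_zero hj hi)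
    rw [hsingle, PiLp.norm_single]
    exact hFb x i hx
  · have : frontierGrad F x = 0 := by
      ext i
      simpa using not_exists_not.1 hzero i
    rwa [this, norm_zero]

/-- The oracle that multiplies the frontier part of the gradient of `F` by a random weight with
law `μ` and shows the rest of the gradient exactly. -/
noncomputable def frontierOracle (F : Vec d → ℝ) (μ : Measure ℝ) [IsProbabilityMeasure μ] :
    StochasticOracle d where
  Sample := ℝ
  law := μ
  grad x θ := gradient F x + (θ - 1) • frontierGrad F x
  measurable_grad := by
    have hgrad := measurable_gradient F
    have hfrontier := measurable_frontierGrad F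
    simp only [Function.uncurry_def]
    fun_prop

variable {μ : Measure ℝ} [IsProbabilityMeasure μ]

theorem isUnbiased_frontierOracle (hμ : Integrable (fun θ => θ) μ) (hmean : ∫ θ, θ ∂μ = 1) :
    (frontierOracle F μ).IsUnbiased F := by
  intro x
  have hnoise : Integrable (fun θ : ℝ => (θ - 1) • frontierGrad F x) μ :=
    (hμ.sub (integrable_const 1)).smul_const _
  have hcentred : ∫ θ, (θ - 1) ∂μ = 0 := by
    rw [integral_sub hμ (integrable_const 1), hmean, integral_const, probReal_univ, one_smul,
      sub_self]
  refine ⟨(integrable_const _).add hnoise, ?_⟩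
  change ∫ θ, (gradient F x + (θ - 1) • frontierGrad F x) ∂μ = gradient F x
  rw [integral_add (integrable_const _) hnoise, integral_smul_const, hcentred, zero_smul,
    add_zero, integral_const, probReal_univ, one_smul]

theorem noiseMomentAtMost_frontierOracle {b p σ M : ℝ} (hb : 0 ≤ b) (hp : 0 ≤ p)
    (hFb : ∀ x, ‖frontierGrad F x‖ ≤ b)
    (hμ : ∫⁻ θ, ‖θ - 1‖ₑ ^ p ∂μ ≤ ENNReal.ofReal M) (hM : b ^ p * M ≤ σ ^ p) :
    (frontierOracle F μ).NoiseMomentAtMost F p σ := by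
  intro x
  calc ∫⁻ θ, ‖(gradient F x + (θ - 1) • frontierGrad F x) - gradient F x‖ₑ ^ p ∂μ
      = ∫⁻ θ, ‖frontierGrad F x‖ₑ ^ p * ‖θ - 1‖ₑ ^ p ∂μ := by
        refine lintegral_congr fun θ => ?_
        rw [add_sub_cancel_left, enorm_smul, mul_comm, ENNReal.mul_rpow_of_nonneg _ _ hp]
    _ = ‖frontierGrad F x‖ₑ ^ p * ∫⁻ θ, ‖θ - 1‖ₑ ^ p ∂μ :=
        lintegral_const_mul _ (by fun_prop)
    _ ≤ ENNReal.ofReal (b ^ p) * ENNReal.ofReal M := by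
        gcongr
        rw [← ofReal_norm, ← ENNReal.ofReal_rpow_of_nonneg hb hp]
        gcongr
        exact hFb x
    _ ≤ ENNReal.ofReal (σ ^ p) := by
        rw [← ENNReal.ofReal_mul (by positivity)]
        exact ENNReal.ofReal_le_ofReal hM

theorem IsZeroChain.isZeroChain_frontierOracle (hF : IsZeroChain F) :
    (frontierOracle F μ).IsZeroChain ({0}ᶜ : Set ℝ) where
  supportedBelow_succ θ hx := (hF _ _ hx).add ((hF.supportedBelow_frontierGrad hx).smul _)
  supportedBelow_of_notMem {x n θ} hθ hx := by
    obtain rfl : θ = (0 : ℝ) := Set.notMem_compl_iff.1 hθ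
    have hhidden : gradient F x + ((0 : ℝ) - 1) • frontierGrad F x
        = gradient F x - frontierGrad F x := by
      rw [zero_sub, neg_one_smul, ← sub_eq_add_neg]
    change SupportedBelow (gradient F x + ((0 : ℝ) - 1) • frontierGrad F x) n
    rw [hhidden]
    exact supportedBelow_gradient_sub_frontierGrad hx

theorem lintegral_bernoulliMeasure_sub_one_rpow_le {q : unitInterval} (hq : (q : ℝ) ≠ 0) {p : ℝ}
    (hp : 1 ≤ p) :
    ∫⁻ θ, ‖θ - 1‖ₑ ^ p ∂bernoulliMeasure (q⁻¹ : ℝ) 0 q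
      ≤ ENNReal.ofReal (2 * (q : ℝ) ^ (1 - p)) := by
  have hq0 : (0 : ℝ) < q := q.2.1.lt_of_ne' hq
  have hp0 : 0 ≤ p := zero_le_one.trans hp
  have hreveal : |(q : ℝ)⁻¹ - 1| ^ p ≤ (q : ℝ) ^ (-p) := by
    rw [Real.rpow_neg hq0.le, ← Real.inv_rpow hq0.le,
      abs_of_nonneg (sub_nonneg.2 ((one_le_inv₀ hq0).2 q.2.2))]
    exact Real.rpow_le_rpow (sub_nonneg.2 ((one_le_inv₀ hq0).2 q.2.2)) (by simp) hp0
  have hone : 1 ≤ (q : ℝ) ^ (1 - p) :=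
    Real.one_le_rpow_of_pos_of_le_one_of_nonpos hq0 q.2.2 (by linarith)
  calc ∫⁻ θ, ‖θ - 1‖ₑ ^ p ∂bernoulliMeasure (q⁻¹ : ℝ) 0 q
      = ∫⁻ θ, ENNReal.ofReal (|θ - 1| ^ p) ∂bernoulliMeasure (q⁻¹ : ℝ) 0 q := by
        simp_rw [Real.enorm_eq_ofReal_abs, ENNReal.ofReal_rpow_of_nonneg (abs_nonneg _) hp0]
    _ = ENNReal.ofReal (q * |(q : ℝ)⁻¹ - 1| ^ p + (1 - q)) := by
        rw [← ofReal_integral_eq_lintegral_ofReal (integrable_bernoulliMeasure _ _ _ _)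
          (.of_forall fun θ => by positivity), integral_bernoulliMeasure]
        simp
    _ ≤ ENNReal.ofReal (q * (q : ℝ) ^ (-p) + 1) := by
        gcongr
        linarith
    _ ≤ ENNReal.ofReal (2 * (q : ℝ) ^ (1 - p)) := by
        gcongr
        rw [sub_eq_add_neg, Real.rpow_add hq0, Real.rpow_one] at hone ⊢
        linarith

end FrontierOracle

section RealVariable

/-- The cutoff that switches on a term of the hard function once `|a|` is of order one. -/
noncomputable def gate (a : ℝ) : ℝ := a ^ 2 / (1 + a ^ 2)

/-- The derivative of `gate`. -/
noncomputable def gateDeriv (a : ℝ) : ℝ := 2 * a / (1 + a ^ 2) ^ 2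

/-- The odd function whose derivative is `2 * |gateDeriv a|`. -/
noncomputable def drift (a : ℝ) : ℝ := 2 * (a * |a|) / (1 + a ^ 2)

theorem one_add_sq_ne_zero (a : ℝ) : 1 + a ^ 2 ≠ 0 := by positivity

theorem one_sub_gate (a : ℝ) : 1 - gate a = 1 / (1 + a ^ 2) := by
  rw [gate, one_sub_div (one_add_sq_ne_zero a), add_sub_cancel_right]

theorem gate_zero : gate 0 = 0 := by simp [gate]

theorem gateDeriv_zero : gateDeriv 0 = 0 := by simp [gateDeriv]

theorem drift_zero : drift 0 = 0 := by simp [drift]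

theorem gate_nonneg (a : ℝ) : 0 ≤ gate a := by unfold gate; positivity

theorem gate_le_one (a : ℝ) : gate a ≤ 1 := by
  rw [gate, div_le_one (by positivity)]
  linarith

theorem abs_gate_le_one (a : ℝ) : |gate a| ≤ 1 := by
  rw [abs_of_nonneg (gate_nonneg a)]
  exact gate_le_one a

theorem abs_one_sub_gate_le_one (a : ℝ) : |1 - gate a| ≤ 1 := by
  rw [abs_of_nonneg (sub_nonneg.2 (gate_le_one a))]
  linarith [gate_nonneg a]

theorem half_le_gate {a : ℝ} (ha : 1 ≤ |a|) : 1 / 2 ≤ gate a := by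
  have : 1 ≤ a ^ 2 := (one_le_sq_iff_one_le_abs a).2 ha
  rw [gate, div_le_div_iff₀ two_pos (by positivity)]
  linarith

theorem gate_le_half {a : ℝ} (ha : |a| ≤ 1) : gate a ≤ 1 / 2 := by
  have : a ^ 2 ≤ 1 := (sq_le_one_iff_abs_le_one a).2 ha
  rw [gate, div_le_div_iff₀ (by positivity) two_pos]
  linarith

theorem abs_gateDeriv_le_one (a : ℝ) : |gateDeriv a| ≤ 1 := by
  rw [gateDeriv, abs_div, abs_of_pos (show 0 < (1 + a ^ 2) ^ 2 by positivity),
    div_le_one (by positivity), abs_le]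
  constructor <;> nlinarith [sq_nonneg (a - 1), sq_nonneg (a + 1), sq_nonneg (a ^ 2)]

theorem abs_drift (a : ℝ) : |drift a| = 2 * gate a := by
  rw [drift, gate, abs_div, abs_of_pos (show 0 < 1 + a ^ 2 by positivity), abs_mul, abs_mul,
    abs_abs, abs_mul_abs_self, abs_two, ← pow_two, mul_div_assoc]

theorem abs_arctan_le_two (a : ℝ) : |Real.arctan a| ≤ 2 := by
  rw [abs_le]
  constructor <;>
    linarith [Real.neg_pi_div_two_lt_arctan a, Real.arctan_lt_pi_div_two a, Real.pi_le_four]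

theorem hasDerivAt_one_add_sq (a : ℝ) : HasDerivAt (fun a : ℝ => 1 + a ^ 2) (2 * a) a := by
  simpa using (hasDerivAt_pow 2 a).const_add 1

theorem hasDerivAt_mul_abs (a : ℝ) : HasDerivAt (fun a : ℝ => a * |a|) (2 * |a|) a := by
  rcases eq_or_ne a 0 with rfl | ha
  · rw [hasDerivAt_iff_tendsto_slope_zero]
    have habs : Filter.Tendsto (fun t : ℝ => |t|) (nhdsWithin 0 {0}ᶜ) (nhds (2 * |0|)) := by
      simpa using (continuous_abs.tendsto (0 : ℝ)).mono_left nhdsWithin_le_nhds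
    refine habs.congr' ?_
    filter_upwards [self_mem_nhdsWithin] with t ht
    simp [inv_mul_cancel_left₀ (Set.mem_compl_singleton_iff.1 ht)]
  · refine ((hasDerivAt_id' a).fun_mul (hasDerivAt_abs ha)).congr_deriv ?_
    rw [self_mul_sign]
    ring

theorem hasDerivAt_gate (a : ℝ) : HasDerivAt gate (gateDeriv a) a := by
  refine ((hasDerivAt_pow 2 a).fun_div (hasDerivAt_one_add_sq a)
    (one_add_sq_ne_zero a)).congr_deriv ?_
  rw [gateDeriv]
  push_cast
  ring

theorem hasDerivAt_gateDeriv (a : ℝ) :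
    HasDerivAt gateDeriv ((2 - 6 * a ^ 2) / (1 + a ^ 2) ^ 3) a := by
  refine (((hasDerivAt_id' a).const_mul 2).fun_div ((hasDerivAt_one_add_sq a).fun_pow 2)
    (pow_ne_zero 2 (one_add_sq_ne_zero a))).congr_deriv ?_
  have := one_add_sq_ne_zero a
  push_cast
  field_simp
  ring

theorem hasDerivAt_drift (a : ℝ) : HasDerivAt drift (2 * |gateDeriv a|) a := by
  refine (((hasDerivAt_mul_abs a).const_mul 2).fun_div (hasDerivAt_one_add_sq a)
    (one_add_sq_ne_zero a)).congr_deriv ?_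
  rw [gateDeriv, abs_div, abs_of_pos (show 0 < (1 + a ^ 2) ^ 2 by positivity), abs_mul, abs_two]
  field_simp
  ring

theorem abs_sub_le_of_hasDerivAt {f f' : ℝ → ℝ} {C : ℝ} (hf : ∀ x, HasDerivAt f (f' x) x)
    (hC : ∀ x, |f' x| ≤ C) (x y : ℝ) : |f x - f y| ≤ C * |x - y| :=
  convex_univ.norm_image_sub_le_of_norm_hasDerivWithin_le
    (fun x _ => (hf x).hasDerivWithinAt) (fun x _ => hC x) (Set.mem_univ y) (Set.mem_univ x)

theorem abs_gate_sub_le (x y : ℝ) : |gate x - gate y| ≤ |x - y| := by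
  simpa using abs_sub_le_of_hasDerivAt hasDerivAt_gate abs_gateDeriv_le_one x y

theorem abs_gateDeriv_sub_le (x y : ℝ) : |gateDeriv x - gateDeriv y| ≤ 2 * |x - y| := by
  refine abs_sub_le_of_hasDerivAt hasDerivAt_gateDeriv (fun a => ?_) x y
  rw [abs_div, abs_of_pos (show 0 < (1 + a ^ 2) ^ 3 by positivity), div_le_iff₀ (by positivity),
    abs_le]
  constructor <;> nlinarith [sq_nonneg (a ^ 2), sq_nonneg (a ^ 3), sq_nonneg a]

theorem abs_arctan_sub_le (x y : ℝ) : |Real.arctan x - Real.arctan y| ≤ |x - y| := by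
  have hderiv (a : ℝ) : |1 / (1 + a ^ 2)| ≤ 1 := one_sub_gate a ▸ abs_one_sub_gate_le_one a
  simpa using abs_sub_le_of_hasDerivAt Real.hasDerivAt_arctan hderiv x y

theorem abs_mul_sub_mul_le {a b a' b' A B : ℝ} (ha : |a| ≤ A) (hb' : |b'| ≤ B) :
    |a * b - a' * b'| ≤ A * |b - b'| + B * |a - a'| :=
  calc |a * b - a' * b'| = |a * (b - b') + b' * (a - a')| := by ring_nf
    _ ≤ |a| * |b - b'| + |b'| * |a - a'| := by
      rw [← abs_mul, ← abs_mul]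
      exact abs_add_le _ _
    _ ≤ A * |b - b'| + B * |a - a'| := by gcongr

/-- The interaction of two neighbouring coordinates in the hard function. The first summand rewards
moving `v` only once `u` has been moved; `drift` makes the whole increasing in `v`. -/
noncomputable def chainLink (u v : ℝ) : ℝ := gate u * Real.arctan v + drift v

/-- The derivative of `chainLink u v + chainLink v w` in `v`. -/
noncomputable def chainSlope (u v w : ℝ) : ℝ :=
  gate u * (1 - gate v) + gateDeriv v * Real.arctan w + 2 * |gateDeriv v|

theorem chainLink_zero_right (u : ℝ) : chainLink u 0 = 0 := by
  rw [chainLink, Real.arctan_zero, drift_zero, mul_zero, add_zero]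

theorem chainSlope_zero_right (u : ℝ) : chainSlope u 0 0 = gate u := by
  simp [chainSlope, gate_zero, gateDeriv_zero]

theorem chainLink_le_four (u v : ℝ) : chainLink u v ≤ 4 := by
  have harctan : gate u * Real.arctan v ≤ 1 * 2 := by
    refine (le_abs_self _).trans ?_
    rw [abs_mul]
    exact mul_le_mul (abs_gate_le_one u) (abs_arctan_le_two v) (abs_nonneg _) zero_le_one
  have hdrift : drift v ≤ 2 * 1 :=
    (le_abs_self _).trans ((abs_drift v).trans_le (by gcongr; exact gate_le_one v))
  rw [chainLink]
  linarith

theorem gate_mul_one_sub_gate_le_chainSlope (u v w : ℝ) :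
    gate u * (1 - gate v) ≤ chainSlope u v w := by
  -- The drift outweighs the pull of the next coordinate.
  have hpull : |gateDeriv v * Real.arctan w| ≤ |gateDeriv v| * 2 := by
    rw [abs_mul]
    gcongr
    exact abs_arctan_le_two w
  rw [chainSlope]
  linarith [(abs_le.1 hpull).1]

theorem abs_chainSlope_sub_le (u v w u' v' w' : ℝ) :
    |chainSlope u v w - chainSlope u' v' w'| ≤ |u - u'| + 9 * |v - v'| + |w - w'| := by
  have hgate := abs_mul_sub_mul_le (b := 1 - gate v) (a' := gate u') (abs_gate_le_one u)
    (abs_one_sub_gate_le_one v')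
  have hpull := abs_mul_sub_mul_le (b := Real.arctan w) (a' := gateDeriv v')
    (abs_gateDeriv_le_one v) (abs_arctan_le_two w')
  have hdrift := abs_abs_sub_abs_le_abs_sub (gateDeriv v) (gateDeriv v')
  have hv := abs_gate_sub_le v v'
  rw [sub_sub_sub_cancel_left, abs_sub_comm (gate v')] at hgate
  have hsum : chainSlope u v w - chainSlope u' v' w'
      = (gate u * (1 - gate v) - gate u' * (1 - gate v'))
        + (gateDeriv v * Real.arctan w - gateDeriv v' * Real.arctan w')
        + 2 * (|gateDeriv v| - |gateDeriv v'|) := by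
    simp only [chainSlope]
    ring
  have htriangle := abs_add_three (gate u * (1 - gate v) - gate u' * (1 - gate v'))
    (gateDeriv v * Real.arctan w - gateDeriv v' * Real.arctan w')
    (2 * (|gateDeriv v| - |gateDeriv v'|))
  rw [← hsum, abs_mul, abs_two] at htriangle
  linarith [abs_gate_sub_le u u', abs_gateDeriv_sub_le v v', abs_arctan_sub_le w w']

theorem hasFDerivAt_chainLink {E : Type*} [NormedAddCommGroup E] [NormedSpace ℝ E] {f g : E → ℝ}
    {f' g' : E →L[ℝ] ℝ} {x : E} (hf : HasFDerivAt f f' x) (hg : HasFDerivAt g g' x) :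
    HasFDerivAt (fun y => chainLink (f y) (g y))
      ((gateDeriv (f x) * Real.arctan (g x)) • f'
        + (gate (f x) * (1 - gate (g x)) + 2 * |gateDeriv (g x)|) • g') x := by
  have hgate := (hasDerivAt_gate (f x)).comp_hasFDerivAt x hf
  have harctan := (Real.hasDerivAt_arctan (g x)).comp_hasFDerivAt x hg
  have hdrift := (hasDerivAt_drift (g x)).comp_hasFDerivAt x hg
  refine ((hgate.mul harctan).add hdrift).congr_fderiv ?_
  simp only [Function.comp_apply, ← one_sub_gate]
  module

end RealVariable

section HardFunction

variable {d : ℕ}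

/-- The coordinates of `x`, preceded by a `1` that gets the chain going and followed by zeros. -/
def pad (x : Vec d) : ℕ → ℝ
  | 0 => 1
  | n + 1 => if h : n < d then x ⟨n, h⟩ else 0

theorem pad_zero (x : Vec d) : pad x 0 = 1 := rfl

theorem pad_succ_val (x : Vec d) (i : Fin d) : pad x (i + 1) = x i := by simp [pad]

theorem SupportedBelow.pad_eq_zero {x : Vec d} {n : ℕ} (hx : SupportedBelow x n) {m : ℕ}
    (hm : n < m) : pad x m = 0 := by
  obtain ⟨m, rfl⟩ := Nat.exists_eq_succ_of_ne_zero (Nat.ne_zero_of_lt hm)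
  simp only [pad]
  split_ifs with hmd
  · exact hx ⟨m, hmd⟩ (Nat.lt_succ_iff.1 hm)
  · rfl

theorem pad_eq_zero_of_lt (x : Vec d) {m : ℕ} (hm : d < m) : pad x m = 0 :=
  SupportedBelow.pad_eq_zero (n := d) (fun i hi => absurd i.isLt hi.not_gt) hm

/-- The derivative of `x ↦ pad x n`. -/
noncomputable def padCLM (d : ℕ) : ℕ → Vec d →L[ℝ] ℝ
  | 0 => 0
  | n + 1 => if h : n < d then EuclideanSpace.proj ⟨n, h⟩ else 0

theorem hasFDerivAt_pad (x : Vec d) (n : ℕ) :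
    HasFDerivAt (fun x : Vec d => pad x n) (padCLM d n) x := by
  rcases n with _ | n
  · exact hasFDerivAt_const 1 x
  · simp only [pad, padCLM]
    split_ifs with h
    · exact (EuclideanSpace.proj (𝕜 := ℝ) (⟨n, h⟩ : Fin d)).hasFDerivAt
    · exact hasFDerivAt_const 0 x

theorem padCLM_succ_val_apply (v : Vec d) (i : Fin d) : padCLM d (i + 1) v = v i := by
  simp [padCLM]

/-- The hard function: a coordinate is worth moving only after the one before it. -/
noncomputable def hardChain (x : Vec d) : ℝ :=
  -∑ n ∈ Finset.range d, chainLink (pad x n) (pad x (n + 1))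

theorem hasFDerivAt_hardChain (x : Vec d) :
    HasFDerivAt hardChain (-∑ n ∈ Finset.range d,
      chainSlope (pad x n) (pad x (n + 1)) (pad x (n + 2)) • padCLM d (n + 1)) x := by
  have hsum := (HasFDerivAt.fun_sum fun n (_ : n ∈ Finset.range d) =>
    hasFDerivAt_chainLink (hasFDerivAt_pad x n) (hasFDerivAt_pad x (n + 1))).neg
  refine hsum.congr_fderiv (congrArg Neg.neg ?_)
  have hshift : ∑ n ∈ Finset.range d, (gateDeriv (pad x n) * Real.arctan (pad x (n + 1))) •
        padCLM d n
      = ∑ n ∈ Finset.range d, (gateDeriv (pad x (n + 1)) * Real.arctan (pad x (n + 2))) •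
        padCLM d (n + 1) := by
    have hends := (Finset.sum_range_succ (fun n =>
      (gateDeriv (pad x n) * Real.arctan (pad x (n + 1))) • padCLM d n) d).symm.trans
      (Finset.sum_range_succ' _ d)
    simpa [pad_eq_zero_of_lt x d.lt_succ_self, padCLM] using hends
  rw [Finset.sum_add_distrib, hshift, ← Finset.sum_add_distrib]
  refine Finset.sum_congr rfl fun n _ => ?_
  rw [chainSlope]
  module

theorem hasGradientAt_hardChain (x : Vec d) :
    HasGradientAt hardChain
      (WithLp.toLp 2 fun i : Fin d => -chainSlope (pad x i) (pad x (i + 1)) (pad x (i + 2))) x := by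
  rw [hasGradientAt_iff_hasFDerivAt]
  refine (hasFDerivAt_hardChain x).congr_fderiv ?_
  ext v
  simp [PiLp.inner_apply, Finset.sum_range, padCLM_succ_val_apply, mul_comm]

theorem differentiable_hardChain : Differentiable ℝ (hardChain : Vec d → ℝ) :=
  fun x => (hasFDerivAt_hardChain x).differentiableAt

theorem gradient_hardChain_apply (x : Vec d) (i : Fin d) :
    gradient hardChain x i = -chainSlope (pad x i) (pad x (i + 1)) (pad x (i + 2)) := by
  rw [(hasGradientAt_hardChain x).gradient]

theorem hardChain_zero : hardChain (0 : Vec d) = 0 := by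
  have hpad (n : ℕ) : pad (0 : Vec d) (n + 1) = 0 := by simp [pad]
  simp [hardChain, hpad, chainLink_zero_right]

theorem neg_le_hardChain (x : Vec d) : -(4 * d : ℝ) ≤ hardChain x := by
  rw [hardChain, neg_le_neg_iff]
  calc ∑ n ∈ Finset.range d, chainLink (pad x n) (pad x (n + 1))
      ≤ ∑ _n ∈ Finset.range d, (4 : ℝ) := Finset.sum_le_sum fun n _ => chainLink_le_four _ _
    _ = 4 * d := by rw [Finset.sum_const, Finset.card_range, nsmul_eq_mul, mul_comm]

theorem initialGapAtMost_hardChain : InitialGapAtMost (hardChain : Vec d → ℝ) (4 * d) := by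
  refine ⟨⟨-(4 * d), Set.forall_mem_range.2 neg_le_hardChain⟩, ?_⟩
  rw [hardChain_zero]
  linarith [le_ciInf (neg_le_hardChain (d := d))]

theorem sum_sq_pad_sub_le (x y : Vec d) (k : ℕ) :
    ∑ i : Fin d, (pad x (i + k) - pad y (i + k)) ^ 2 ≤ ‖x - y‖ ^ 2 := by
  set e : ℕ → ℝ := fun m => (pad x m - pad y m) ^ 2
  have he (m : ℕ) (hm : m ∉ Finset.Ico 1 (d + 1)) : e m = 0 := by
    obtain rfl | hm : m = 0 ∨ d < m := by grind
    · simp [e, pad_zero]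
    · simp [e, pad_eq_zero_of_lt _ hm]
  calc ∑ i : Fin d, e (i + k)
      = ∑ m ∈ Finset.Ico k (d + k), e m := by
        simp [Finset.sum_Ico_eq_sum_range, Finset.sum_range, add_comm]
    _ ≤ ∑ m ∈ Finset.Ico k (d + k) ∪ Finset.Ico 1 (d + 1), e m :=
        Finset.sum_le_sum_of_subset_of_nonneg Finset.subset_union_left
          fun _ _ _ => sq_nonneg _
    _ = ∑ m ∈ Finset.Ico 1 (d + 1), e m :=
        (Finset.sum_subset Finset.subset_union_right fun m _ hm => he m hm).symm
    _ = ‖x - y‖ ^ 2 := by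
        simp [Finset.sum_Ico_eq_sum_range, EuclideanSpace.real_norm_sq_eq, Finset.sum_range,
          e, add_comm 1, pad_succ_val]

theorem norm_gradient_hardChain_sub_le (x y : Vec d) :
    ‖gradient hardChain x - gradient hardChain y‖ ≤ 16 * ‖x - y‖ := by
  have hterm (i : Fin d) : (gradient hardChain x i - gradient hardChain y i) ^ 2
      ≤ 83 * ((pad x (i + 0) - pad y (i + 0)) ^ 2 + (pad x (i + 1) - pad y (i + 1)) ^ 2
        + (pad x (i + 2) - pad y (i + 2)) ^ 2) := by
    rw [gradient_hardChain_apply, gradient_hardChain_apply, neg_sub_neg, ← neg_sub, neg_sq]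
    have h := abs_chainSlope_sub_le (pad x i) (pad x (i + 1)) (pad x (i + 2))
      (pad y i) (pad y (i + 1)) (pad y (i + 2))
    rw [add_zero, ← sq_abs, ← sq_abs (pad x i - _), ← sq_abs (pad x (i + 1) - _),
      ← sq_abs (pad x (i + 2) - _)]
    set a := |pad x i - pad y i|
    set b := |pad x (i + 1) - pad y (i + 1)|
    set c := |pad x (i + 2) - pad y (i + 2)|
    refine (pow_le_pow_left₀ (abs_nonneg _) h 2).trans ?_
    nlinarith [sq_nonneg (9 * a - b), sq_nonneg (a - c), sq_nonneg (9 * c - b)]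
  have hsq : ‖gradient hardChain x - gradient hardChain y‖ ^ 2 ≤ 249 * ‖x - y‖ ^ 2 := by
    rw [EuclideanSpace.real_norm_sq_eq]
    refine (Finset.sum_le_sum fun i _ => hterm i).trans ?_
    rw [← Finset.mul_sum, Finset.sum_add_distrib, Finset.sum_add_distrib]
    linarith [sum_sq_pad_sub_le x y 0, sum_sq_pad_sub_le x y 1, sum_sq_pad_sub_le x y 2]
  refine abs_le_of_sq_le_sq' (hsq.trans ?_) (by positivity) |>.2
  nlinarith [sq_nonneg ‖x - y‖]

theorem isSmoothFun_hardChain : IsSmoothFun (hardChain : Vec d → ℝ) 16 :=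
  ⟨differentiable_hardChain, norm_gradient_hardChain_sub_le⟩

theorem isZeroChain_hardChain : IsZeroChain (hardChain : Vec d → ℝ) := fun x n hx i hi => by
  rw [gradient_hardChain_apply, hx.pad_eq_zero (by lia), hx.pad_eq_zero (by lia),
    hx.pad_eq_zero (by lia), chainSlope_zero_right, gate_zero, neg_zero]

theorem abs_gradient_hardChain_apply_le_one {x : Vec d} {i : Fin d} (hx : SupportedBelow x i) :
    |gradient hardChain x i| ≤ 1 := by
  rw [gradient_hardChain_apply, abs_neg, hx.pad_eq_zero (m := i + 1) (by lia),
    hx.pad_eq_zero (m := i + 2) (by lia), chainSlope_zero_right]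
  exact abs_gate_le_one _

theorem quarter_le_norm_gradient_hardChain {x : Vec d} {n : ℕ} (hn : n < d)
    (hx : SupportedBelow x n) : 1 / 4 ≤ ‖gradient hardChain x‖ := by
  have hxn : |pad x (n + 1)| ≤ 1 := by simp [hx.pad_eq_zero n.lt_succ_self]
  have hsmall : ∃ m, |pad x (m + 1)| ≤ 1 := ⟨n, hxn⟩
  classical
  -- The gradient is large at the first small coordinate, since its predecessor is not small.
  set m := Nat.find hsmall
  have hmd : m < d := (Nat.find_min' hsmall hxn).trans_lt hn
  have hprev : 1 ≤ |pad x m| := by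
    rcases hm : m with _ | k
    · simp [pad_zero]
    · exact (not_le.1 (Nat.find_min hsmall (m := k) (by lia))).le
  calc (1 / 4 : ℝ) = 1 / 2 * (1 - 1 / 2) := by norm_num
    _ ≤ gate (pad x m) * (1 - gate (pad x (m + 1))) := by
      gcongr
      · exact gate_nonneg _
      · exact half_le_gate hprev
      · exact gate_le_half (Nat.find_spec hsmall)
    _ ≤ chainSlope (pad x m) (pad x (m + 1)) (pad x (m + 2)) :=
      gate_mul_one_sub_gate_le_chainSlope _ _ _
    _ ≤ ‖gradient hardChain x ⟨m, hmd⟩‖ := by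
      rw [gradient_hardChain_apply, norm_neg]
      exact le_abs_self _
    _ ≤ ‖gradient hardChain x‖ := PiLp.norm_apply_le _ _

end HardFunction

section Rescaling

theorem hasGradientAt_const_mul_comp_smul {E : Type*} [NormedAddCommGroup E]
    [InnerProductSpace ℝ E] [CompleteSpace E] {f : E → ℝ} {g x : E} {k : ℝ}
    (hf : HasGradientAt f g (k • x)) (c : ℝ) :
    HasGradientAt (fun y => c * f (k • y)) ((c * k) • g) x := by
  rw [hasGradientAt_iff_hasFDerivAt] at hf ⊢
  have hscale : HasFDerivAt (fun y : E => k • y) (k • ContinuousLinearMap.id ℝ E) x :=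
    (hasFDerivAt_id x).const_smul k
  refine ((hf.comp x hscale).const_mul c).congr_fderiv ?_
  ext v
  simp [mul_assoc]

variable {d : ℕ} {F : Vec d → ℝ} {b l : ℝ}

/-- `F` on the length scale `l`, with its gradient multiplied by `b`. -/
noncomputable def rescale (b l : ℝ) (F : Vec d → ℝ) (x : Vec d) : ℝ := b * l * F (l⁻¹ • x)

theorem hasGradientAt_rescale (hF : Differentiable ℝ F) (hl : l ≠ 0) (x : Vec d) :
    HasGradientAt (rescale b l F) (b • gradient F (l⁻¹ • x)) x := by
  have h := hasGradientAt_const_mul_comp_smul (hF (l⁻¹ • x)).hasGradientAt (b * l)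
  rwa [mul_inv_cancel_right₀ hl] at h

theorem gradient_rescale (hF : Differentiable ℝ F) (hl : l ≠ 0) (x : Vec d) :
    gradient (rescale b l F) x = b • gradient F (l⁻¹ • x) :=
  (hasGradientAt_rescale hF hl x).gradient

theorem iInf_rescale (hb : 0 ≤ b) (hl : 0 < l) : ⨅ x, rescale b l F x = b * l * ⨅ x, F x := by
  have hsurj : Function.Surjective fun x : Vec d => l⁻¹ • x :=
    (Homeomorph.smulOfNeZero l⁻¹ (inv_ne_zero hl.ne')).surjective
  rw [← hsurj.iInf_comp F, Real.mul_iInf_of_nonneg (mul_nonneg hb hl.le)]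
  rfl

theorem InitialGapAtMost.rescale {Δ : ℝ} (hF : InitialGapAtMost F Δ) (hb : 0 ≤ b) (hl : 0 < l) :
    InitialGapAtMost (rescale b l F) (b * l * Δ) := by
  obtain ⟨⟨m, hm⟩, hgap⟩ := hF
  constructor
  · refine ⟨b * l * m, Set.forall_mem_range.2 fun x => ?_⟩
    exact mul_le_mul_of_nonneg_left (hm ⟨l⁻¹ • x, rfl⟩) (mul_nonneg hb hl.le)
  · rw [iInf_rescale hb hl, _root_.rescale, smul_zero, ← mul_sub]
    exact mul_le_mul_of_nonneg_left hgap (mul_nonneg hb hl.le)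

theorem IsSmoothFun.rescale {L : ℝ} (hF : IsSmoothFun F L) (hb : 0 ≤ b) (hl : 0 < l) :
    IsSmoothFun (rescale b l F) (b * l⁻¹ * L) := by
  refine ⟨fun x => (hasGradientAt_rescale hF.1 hl.ne' x).differentiableAt, fun x y => ?_⟩
  rw [gradient_rescale hF.1 hl.ne', gradient_rescale hF.1 hl.ne', ← smul_sub,
    norm_smul_of_nonneg hb]
  calc b * ‖gradient F (l⁻¹ • x) - gradient F (l⁻¹ • y)‖
      ≤ b * (L * ‖l⁻¹ • x - l⁻¹ • y‖) := by gcongr; exact hF.2 _ _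
    _ = b * l⁻¹ * L * ‖x - y‖ := by
      rw [← smul_sub, norm_smul_of_nonneg (inv_nonneg.2 hl.le)]
      ring

theorem IsZeroChain.rescale (hF : IsZeroChain F) (hdiff : Differentiable ℝ F) (hl : l ≠ 0) :
    IsZeroChain (rescale b l F) := fun x n hx => by
  rw [gradient_rescale hdiff hl]
  exact (hF _ n (hx.smul _)).smul b

end Rescaling

section LowerBound

/-- The hard function with Lipschitz constant `L` whose gradient entries at the frontier are at
most `b`. -/
noncomputable def hardObjective (d : ℕ) (L b : ℝ) : Vec d → ℝ := rescale b (16 * b / L) hardChain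

variable {d : ℕ} {L b : ℝ}

theorem gradient_hardObjective (hL : 0 < L) (hb : 0 < b) (x : Vec d) :
    gradient (hardObjective d L b) x = b • gradient hardChain ((16 * b / L)⁻¹ • x) :=
  gradient_rescale differentiable_hardChain (by positivity) x

theorem initialGapAtMost_hardObjective (hL : 0 < L) (hb : 0 < b) {Δ : ℝ}
    (hd : 64 * b ^ 2 * d ≤ Δ * L) : InitialGapAtMost (hardObjective d L b) Δ := by
  have hgap := initialGapAtMost_hardChain (d := d).rescale hb.le (by positivity : 0 < 16 * b / L)
  refine ⟨hgap.1, hgap.2.trans ?_⟩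
  calc b * (16 * b / L) * (4 * d) = 64 * b ^ 2 * d / L := by ring
    _ ≤ Δ := (div_le_iff₀ hL).2 hd

theorem isSmoothFun_hardObjective (hL : 0 < L) (hb : 0 < b) :
    IsSmoothFun (hardObjective d L b) L := by
  have h := isSmoothFun_hardChain.rescale (d := d) hb.le (by positivity : 0 < 16 * b / L)
  rwa [show b * (16 * b / L)⁻¹ * 16 = L by field_simp] at h

theorem isZeroChain_hardObjective (hL : 0 < L) (hb : 0 < b) :
    IsZeroChain (hardObjective d L b) :=
  isZeroChain_hardChain.rescale differentiable_hardChain (by positivity)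

theorem abs_gradient_hardObjective_apply_le (hL : 0 < L) (hb : 0 < b) {x : Vec d} {i : Fin d}
    (hx : SupportedBelow x i) : |gradient (hardObjective d L b) x i| ≤ b := by
  rw [gradient_hardObjective hL hb, PiLp.smul_apply, smul_eq_mul, abs_mul, abs_of_pos hb]
  exact mul_le_of_le_one_right hb.le (abs_gradient_hardChain_apply_le_one (hx.smul _))

theorem le_norm_gradient_hardObjective (hL : 0 < L) (hb : 0 < b) {x : Vec d} {n : ℕ} (hn : n < d)
    (hx : SupportedBelow x n) : b / 4 ≤ ‖gradient (hardObjective d L b) x‖ := by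
  rw [gradient_hardObjective hL hb, norm_smul_of_nonneg hb.le, div_eq_mul_one_div]
  exact mul_le_mul_of_nonneg_left (quarter_le_norm_gradient_hardChain hn (hx.smul _)) hb.le

/-- The oracle for `hardObjective` that shows the frontier entry, inflated by `1 / q`, with
probability `q` only. -/
noncomputable def hardOracle (d : ℕ) (L b : ℝ) (q : unitInterval) : StochasticOracle d :=
  frontierOracle (hardObjective d L b) (bernoulliMeasure (q⁻¹ : ℝ) 0 q)

variable {q : unitInterval}

theorem isUnbiased_hardOracle (hq : (q : ℝ) ≠ 0) :
    (hardOracle d L b q).IsUnbiased (hardObjective d L b) := by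
  refine isUnbiased_frontierOracle (integrable_bernoulliMeasure _ _ _ _) ?_
  simp [integral_bernoulliMeasure, hq]

theorem noiseMomentAtMost_hardOracle {p σ : ℝ} (hL : 0 < L) (hb : 0 < b) (hq : (q : ℝ) ≠ 0)
    (hp : 1 ≤ p) (hσ : 2 * b ^ p ≤ σ ^ p * (q : ℝ) ^ (p - 1)) :
    (hardOracle d L b q).NoiseMomentAtMost (hardObjective d L b) p σ := by
  have hq0 : (0 : ℝ) < q := q.2.1.lt_of_ne' hq
  refine noiseMomentAtMost_frontierOracle hb.le (zero_le_one.trans hp)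
    ((isZeroChain_hardObjective hL hb).norm_frontierGrad_le hb.le
      fun x i => abs_gradient_hardObjective_apply_le hL hb)
    (lintegral_bernoulliMeasure_sub_one_rpow_le hq hp) ?_
  rw [← neg_sub p, Real.rpow_neg hq0.le, ← mul_assoc, ← div_eq_mul_inv,
    div_le_iff₀ (by positivity), mul_comm (b ^ p)]
  exact hσ

theorem hardOracle_law_compl_zero (hq : (q : ℝ) ≠ 0) :
    (hardOracle d L b q).law ({0}ᶜ : Set ℝ) = ENNReal.ofReal q := by
  change bernoulliMeasure (q⁻¹ : ℝ) 0 q {0}ᶜ = ENNReal.ofReal q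
  rw [← ofReal_measureReal, bernoulliMeasure_real_apply_of_mem_of_notMem _
    (measurableSet_singleton 0).compl (inv_ne_zero hq) (Set.notMem_compl_iff.2 rfl)]

theorem le_expectedGradNorm_hardOracle (hL : 0 < L) (hb : 0 < b) (hq : (q : ℝ) ≠ 0)
    (A : FirstOrderAlgorithm.{u} d) (hA : A.IsZeroRespecting (hardOracle d L b q)) {t : ℕ}
    (ht : 2 * (t * (q : ℝ)) < d) :
    ENNReal.ofReal (b / 8) ≤ A.expectedGradNorm (hardOracle d L b q) (hardObjective d L b) t := by
  have hhalf : ENNReal.ofReal (b / 8) = ENNReal.ofReal (b / 4) * 2⁻¹ := by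
    rw [← ENNReal.ofReal_ofNat, ← ENNReal.ofReal_inv_of_pos two_pos,
      ← ENNReal.ofReal_mul (by positivity)]
    ring_nf
  rw [hhalf]
  refine (isZeroChain_hardObjective hL hb).isZeroChain_frontierOracle.half_mul_le_expectedGradNorm
    (measurableSet_singleton (0 : ℝ)).compl (fun x n hn hx => ?_) A hA ?_
  · rw [← ofReal_norm]
    exact ENNReal.ofReal_le_ofReal (le_norm_gradient_hardObjective hL hb hn hx)
  · change 2 * (t * (hardOracle d L b q).law ({0}ᶜ : Set ℝ)) < d
    rw [hardOracle_law_compl_zero hq, ← ENNReal.ofReal_natCast t, ← ENNReal.ofReal_natCast d,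
      ← ENNReal.ofReal_ofNat, ← ENNReal.ofReal_mul (by positivity),
      ← ENNReal.ofReal_mul (by positivity)]
    have hnonneg := q.2.1
    exact (ENNReal.ofReal_lt_ofReal_iff_of_nonneg (by positivity)).2 ht

end LowerBound

section Parameters

theorem two_mul_rpow_le {p a b σ : ℝ} (hp : 1 < p) (hb : 0 < b) (hab : 2 * b ≤ a) (hσ : 0 < σ) :
    2 * b ^ p ≤ σ ^ p * ((a / σ) ^ (p / (p - 1))) ^ (p - 1) := by
  have ha : 0 < a := by linarith
  have htwo : (2 : ℝ) ≤ 2 ^ p := Real.self_le_rpow_of_one_le one_le_two hp.le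
  calc 2 * b ^ p ≤ 2 ^ p * b ^ p := by gcongr
    _ = (2 * b) ^ p := (Real.mul_rpow zero_le_two hb.le).symm
    _ ≤ a ^ p := by gcongr
    _ = σ ^ p * (a / σ) ^ p := by
      rw [← Real.mul_rpow hσ.le (by positivity), mul_div_cancel₀ _ hσ.ne']
    _ = σ ^ p * ((a / σ) ^ (p / (p - 1))) ^ (p - 1) := by
      rw [← Real.rpow_mul (by positivity), div_mul_cancel₀ p (sub_pos.2 hp).ne']

theorem iteration_bound_eq {p ε σ : ℝ} (hp : 1 < p) (hε : 0 < ε) (hσ : 0 < σ) (Δ L : ℝ) :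
    1 / (65536 * 32 ^ (p / (p - 1)))
        * (Δ * L * σ ^ (p / (p - 1)) * ε ^ (-((3 * p - 2) / (p - 1))))
      = Δ * L / (16384 * ε ^ 2) / (4 * (32 * ε / σ) ^ (p / (p - 1))) := by
  have hp0 : p - 1 ≠ 0 := (sub_pos.2 hp).ne'
  have hexponent : (3 * p - 2) / (p - 1) = 2 + p / (p - 1) := by
    field_simp
    ring
  rw [hexponent, Real.rpow_neg hε.le, Real.rpow_add hε, Real.rpow_ofNat,
    Real.div_rpow (by positivity) hσ.le, Real.mul_rpow (by norm_num) hε.le]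
  field_simp
  ring

theorem one_le_div_sq_of_le_sqrt {a ε : ℝ} (ha : 0 ≤ a) (hε : 0 < ε) (h : ε ≤ √a / 128) :
    1 ≤ a / (16384 * ε ^ 2) := by
  have hsq := pow_le_pow_left₀ (by positivity) ((le_div_iff₀ (by norm_num)).1 h) 2
  rw [Real.sq_sqrt ha] at hsq
  rw [one_le_div (by positivity)]
  linarith

end Parameters

theorem mainTheorem3_general (p : ℝ) (hp : 1 < p) :
    ∃ c : ℝ, 0 < c ∧
      ∀ Δ₁ L₀ σ₀ : ℝ, 0 < Δ₁ → 0 < L₀ → 0 < σ₀ →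
        ∃ ε₀ : ℝ, 0 < ε₀ ∧ ∀ ε : ℝ, 0 < ε → ε ≤ ε₀ →
          ∃ (d : ℕ) (F : Vec d → ℝ) (O : StochasticOracle d),
            InitialGapAtMost F Δ₁ ∧ IsSmoothFun F L₀ ∧
            O.IsUnbiased F ∧ O.NoiseMomentAtMost F p σ₀ ∧
            ∀ A : FirstOrderAlgorithm.{u} d, A.IsZeroRespecting O →
              ∀ t : ℕ,
                ((t + 1 : ℕ) : ℝ) ≤
                  c * (Δ₁ * L₀ * σ₀ ^ (p / (p - 1)) * ε ^ (-((3 * p - 2) / (p - 1)))) →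
                ENNReal.ofReal ε < A.expectedGradNorm O F t := by
  refine ⟨1 / (65536 * 32 ^ (p / (p - 1))), by positivity, fun Δ L σ hΔ hL hσ =>
    ⟨min (σ / 32) (√(Δ * L) / 128), by positivity, fun ε hε hεle => ?_⟩⟩
  obtain ⟨hεσ, hεΔ⟩ := le_min_iff.1 hεle
  set q : unitInterval := ⟨(32 * ε / σ) ^ (p / (p - 1)), by positivity,
    Real.rpow_le_one (by positivity) ((div_le_one hσ).2 (by linarith))
      (div_nonneg (by linarith) (by linarith))⟩
  have hq : 0 < (q : ℝ) := by positivity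
  have hb : 0 < 16 * ε := by positivity
  set X := Δ * L / (16384 * ε ^ 2) with hX
  have hX1 : 1 ≤ X := one_le_div_sq_of_le_sqrt (by positivity) hε hεΔ
  have hgap : 64 * (16 * ε) ^ 2 * ⌊X⌋₊ ≤ Δ * L := by
    have hfloor := Nat.floor_le (zero_le_one.trans hX1)
    rw [hX, le_div_iff₀ (by positivity)] at hfloor
    linarith
  refine ⟨⌊X⌋₊, hardObjective _ L (16 * ε), hardOracle _ L (16 * ε) q,
    initialGapAtMost_hardObjective hL hb hgap, isSmoothFun_hardObjective hL hb,
    isUnbiased_hardOracle hq.ne', noiseMomentAtMost_hardOracle hL hb hq.ne' hp.le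
      (two_mul_rpow_le hp hb (by linarith) hσ), fun A hA t ht => ?_⟩
  have hqueries : 2 * (t * (q : ℝ)) < ⌊X⌋₊ := by
    rw [iteration_bound_eq hp hε hσ, le_div_iff₀ (by positivity)] at ht
    push_cast at ht
    linarith [Nat.div_two_lt_floor hX1]
  calc ENNReal.ofReal ε < ENNReal.ofReal (16 * ε / 8) :=
        (ENNReal.ofReal_lt_ofReal_iff (by positivity)).2 (by linarith)
    _ ≤ _ := le_expectedGradNorm_hardOracle hL hb hq.ne' A hA hqueries

theorem mainTheorem3 (p : ℝ) (hp1 : 1 < p) (hp2 : p ≤ 2) :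
    ∃ c : ℝ, 0 < c ∧
      ∀ Δ₁ L₀ σ₀ : ℝ, 0 < Δ₁ → 0 < L₀ → 0 < σ₀ →
        ∃ ε₀ : ℝ, 0 < ε₀ ∧ ∀ ε : ℝ, 0 < ε → ε ≤ ε₀ →
          ∃ (d : ℕ) (F : Vec d → ℝ) (O : StochasticOracle d),
            InitialGapAtMost F Δ₁ ∧ IsSmoothFun F L₀ ∧
            O.IsUnbiased F ∧ O.NoiseMomentAtMost F p σ₀ ∧
            ∀ A : FirstOrderAlgorithm.{u} d, A.IsZeroRespecting O → A.StartsAt O 0 →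
              ∀ t : ℕ,
                ((t + 1 : ℕ) : ℝ) ≤
                  c * (Δ₁ * L₀ * σ₀ ^ (p / (p - 1)) * ε ^ (-((3 * p - 2) / (p - 1)))) →
                ENNReal.ofReal ε < A.expectedGradNorm O F t := by
  peel mainTheorem3_general.{u} p hp1
  exact fun _ => this
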